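/- Let $n\ge 1$ and $0<\varepsilon\le\frac12$. In the GL problem with bias $\varepsilon$ there is a hidden string $a\in\{0,1\}^n$, and information about $a$ is available only through two kinds of black-box queries. An IP query on $x\in\{0,1\}^n$ returns a bit $\mathrm{IP}(x)$, where $\mathrm{IP}:\{0,1\}^n\to\{0,1\}$ is a fixed but arbitrary function with $\Pr_x[\mathrm{IP}(x)=a\cdot x]\ge\frac12+\varepsilon$ for uniformly random $x$ ($a\cdot x$ being the inner product modulo two). An EQ query on $x\in\{0,1\}^n$ returns $1$ if $x=a$ and $0$ otherwise. A classical probabilistic algorithm is a probability distribution over adaptive deterministic decision trees making IP and EQ queries and outputting a string. It solves the GL problem with success probability $\delta$ if for every $a$ and every such function $\mathrm{IP}$ it outputs $a$ with probability at least $\delta$. Its numbers of queries are counted in the worst case over $a$, $\mathrm{IP}$ and its internal randomness. **Theorem.** There are absolute constants $c,K>0$ such that, for all $n\ge1$, all $\varepsilon$ with $\sqrt n\,2^{-n/3}\le\varepsilon\le\frac12$ and all $\delta>0$ with $\delta n\ge K$, any classical probabilistic algorithm that solves the GL problem with success probability $\delta$ makes either more than $2^{n/2}$ EQ queries or at least $c\,\delta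 n/\varepsilon^2$ IP queries (that is, $\Omega(\delta n/\varepsilon^2)$ of them, with a constant independent of $n$, $\varepsilon$, $\delta$ and the algorithm). In particular, for each fixed $\delta>0$ this holds for all sufficiently large $n$. -/

import Mathlib

namespace GLProblem

/-- The set `{0,1}^n` of bit strings of length `n`, as vectors over the field with two elements. -/
abbrev Str (n : ℕ) : Type := Fin n → ZMod 2

/-- `IP` is a classical inner product black box for the hidden string `a` with bias `ε`:
for uniformly random `x`, the bit `IP x` equals the inner product `a · x` modulo two
with probability at least `1/2 + ε`. -/
def IsIPBox {n : ℕ} (ε : ℝ) (a : Str n) (IP : Str n → ZMod 2) : Prop :=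
  1 / 2 + ε ≤
    ((Finset.univ.filter fun x : Str n => IP x = a ⬝ᵥ x).card : ℝ) / (2 : ℝ) ^ n

/-- The equivalence black box for the hidden string `a`: output 1 if `x = a`, and 0 otherwise. -/
def EQBox {n : ℕ} (a : Str n) (x : Str n) : ZMod 2 := if x = a then 1 else 0

/-- A deterministic (adaptive) query algorithm: a decision tree whose inner nodes are IP queries
and EQ queries, in any order, and whose leaves carry the string that is output. -/
inductive DecisionTree (n : ℕ) : Type
  | output (s : Str n) : DecisionTree n
  | queryIP (x : Str n) (next : ZMod 2 → DecisionTree n) : DecisionTree n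
  | queryEQ (x : Str n) (next : ZMod 2 → DecisionTree n) : DecisionTree n

namespace DecisionTree

variable {n : ℕ}

/-- The output of the run of a decision tree on the given black boxes. -/
def run (IP EQ : Str n → ZMod 2) : DecisionTree n → Str n
  | output s => s
  | queryIP x next => run IP EQ (next (IP x))
  | queryEQ x next => run IP EQ (next (EQ x))

/-- The number of IP queries made in the run on the given black boxes. -/
def countIP (IP EQ : Str n → ZMod 2) : DecisionTree n → ℕ
  | output _ => 0
  | queryIP x next => countIP IP EQ (next (IP x)) + 1
  | queryEQ x next => countIP IP EQ (next (EQ x))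

/-- The number of EQ queries made in the run on the given black boxes. -/
def countEQ (IP EQ : Str n → ZMod 2) : DecisionTree n → ℕ
  | output _ => 0
  | queryIP x next => countEQ IP EQ (next (IP x))
  | queryEQ x next => countEQ IP EQ (next (EQ x)) + 1

end DecisionTree

/-- A classical probabilistic query algorithm: a probability distribution on deterministic ones,
the tree being determined by the outcome of the internal coin tosses. -/
abbrev ProbAlgorithm (n : ℕ) : Type := PMF (DecisionTree n)

/-- `A` solves the GL problem with bias `ε` with success probability `δ`: for every hidden string
`a` and every IP box for `a` with bias `ε`, the output is `a` with probability at least `δ`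
(over the internal randomness of `A`). -/
def Solves {n : ℕ} (A : ProbAlgorithm n) (ε δ : ℝ) : Prop :=
  ∀ (a : Str n) (IP : Str n → ZMod 2), IsIPBox ε a IP →
    ENNReal.ofReal δ ≤ (A.map fun T => T.run IP (EQBox a)) a

/-- In the worst case (over instances of the GL problem with bias `ε` and outcomes of the internal
randomness that have positive probability), `A` makes more than `q` EQ queries. -/
def MakesMoreEQ {n : ℕ} (A : ProbAlgorithm n) (ε q : ℝ) : Prop :=
  ∃ (a : Str n) (IP : Str n → ZMod 2), IsIPBox ε a IP ∧
    ∃ T ∈ A.support, q < (T.countEQ IP (EQBox a) : ℝ)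

/-- In the worst case (over instances of the GL problem with bias `ε` and outcomes of the internal
randomness that have positive probability), `A` makes at least `q` IP queries. -/
def MakesAtLeastIP {n : ℕ} (A : ProbAlgorithm n) (ε q : ℝ) : Prop :=
  ∃ (a : Str n) (IP : Str n → ZMod 2), IsIPBox ε a IP ∧
    ∃ T ∈ A.support, q ≤ (T.countIP IP (EQBox a) : ℝ)

end GLProblem

namespace GLProblem

/-! ### Expectations over independent coordinates. -/

section ProductExpectation

/-! The argument is information-theoretic. For each `a`, take a random box answering each query
independently, correctly with probability `1/2 + β`, where `β` is `2ε` capped at `1/2`. By Chebyshev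
it has bias `ε` with probability at least `1/2`, so on average over `a` the algorithm hits `a` on a
valid box with probability at least `δ/2`.

Compare with uniformly random answers. They carry no information on `a`, so with at most `m` EQ
queries the hit probabilities sum over `a` to at most `m + 1` (`sum_hitInd_le`). Each IP query adds
at most `4β²` to the relative entropy between the two models, so Donsker–Varadhan
(`mul_productExpect_hitInd_le`) gives `l P(hit) ≤ 4β² q + exp l · P_unif(hit)`. With `exp l = 2^n /
(m + 1)`, averaging over `a` yields `l δ/2 ≤ 16 ε² q + 1` (`log_mul_le_of_solves`). For `m ≤
2^(n/2)`, `l` is of order `n`, which forces `q` to be of order `δ n / ε²`. -/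

theorem prod_weights_update {ι κ : Type*} [Fintype ι] [DecidableEq ι] (w : ι → κ → ℝ)
    (f : ι → κ) (x : ι) (b : κ) :
    (∏ i, w i (Function.update f x b i)) * w x (f x) = (∏ i, w i (f i)) * w x b := by
  rw [← Finset.mul_prod_erase Finset.univ _ (Finset.mem_univ x),
    ← Finset.mul_prod_erase Finset.univ (fun i => w i (f i)) (Finset.mem_univ x)]
  have h : ∏ i ∈ Finset.univ.erase x, w i (Function.update f x b i) =
      ∏ i ∈ Finset.univ.erase x, w i (f i) :=
    Finset.prod_congr rfl fun i hi => by
      rw [Function.update_of_ne (Finset.ne_of_mem_erase hi)]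
  rw [h, Function.update_self]
  ring

variable {ι κ : Type*} [Fintype ι] [DecidableEq ι] [Fintype κ]

/-- The expectation of `F f` when the values `f i` are drawn independently with weights `w i`. -/
noncomputable def productExpect (w : ι → κ → ℝ) (F : (ι → κ) → ℝ) : ℝ :=
  ∑ f, (∏ i, w i (f i)) * F f

theorem sum_prod_weights {w : ι → κ → ℝ} (hw : ∀ i, ∑ b, w i b = 1) :
    ∑ f : ι → κ, ∏ i, w i (f i) = 1 := by
  have h := Finset.prod_univ_sum (fun _ : ι => (Finset.univ : Finset κ)) w
  rw [Fintype.piFinset_univ] at h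
  rw [← h]
  simp [hw]

theorem productExpect_const {w : ι → κ → ℝ} (hw : ∀ i, ∑ b, w i b = 1) (c : ℝ) :
    productExpect w (fun _ => c) = c := by
  rw [productExpect, ← Finset.sum_mul, sum_prod_weights hw, one_mul]

theorem productExpect_mono {w : ι → κ → ℝ} (hw : ∀ i b, 0 ≤ w i b) {F G : (ι → κ) → ℝ}
    (h : ∀ f, F f ≤ G f) : productExpect w F ≤ productExpect w G :=
  Finset.sum_le_sum fun f _ =>
    mul_le_mul_of_nonneg_left (h f) (Finset.prod_nonneg fun i _ => hw i _)

theorem productExpect_sum {α : Type*} (s : Finset α) (w : ι → κ → ℝ) (F : α → (ι → κ) → ℝ) :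
    productExpect w (fun f => ∑ j ∈ s, F j f) = ∑ j ∈ s, productExpect w (F j) := by
  simp only [productExpect, Finset.mul_sum]
  exact Finset.sum_comm

theorem productExpect_const_mul (w : ι → κ → ℝ) (c : ℝ) (F : (ι → κ) → ℝ) :
    productExpect w (fun f => c * F f) = c * productExpect w F := by
  simp only [productExpect, Finset.mul_sum]
  exact Finset.sum_congr rfl fun f _ => by ring

/-- Resampling one coordinate does not change the expectation. -/
theorem productExpect_resample {w : ι → κ → ℝ} (hw : ∀ i, ∑ b, w i b = 1) (x : ι)
    (F : (ι → κ) → ℝ) :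
    productExpect w F =
      ∑ b, w x b * productExpect w (fun f => F (Function.update f x b)) := by
  have h1 : ∑ p : (ι → κ) × κ, (∏ i, w i (p.1 i)) * w x p.2 * F (Function.update p.1 x p.2) =
      ∑ p : (ι → κ) × κ, (∏ i, w i (p.1 i)) * w x p.2 * F p.1 := by
    -- Swapping the fresh value with coordinate `x` is a weight-preserving involution.
    let e : (ι → κ) × κ → (ι → κ) × κ := fun p => (Function.update p.1 x p.2, p.1 x)
    have he : Function.Involutive e := fun p => by simp [e]
    refine Fintype.sum_equiv he.toPerm _ _ fun p => ?_
    change _ = (∏ i, w i (Function.update p.1 x p.2 i)) * w x (p.1 x) *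
      F (Function.update p.1 x p.2)
    rw [prod_weights_update]
  rw [Fintype.sum_prod_type, Fintype.sum_prod_type] at h1
  calc productExpect w F
      = ∑ f, ∑ b, (∏ i, w i (f i)) * w x b * F f := by
        refine Finset.sum_congr rfl fun f _ => ?_
        rw [← Finset.sum_mul, ← Finset.mul_sum, hw, mul_one]
    _ = _ := by
        rw [← h1, Finset.sum_comm]
        simp only [productExpect, Finset.mul_sum]
        exact Finset.sum_congr rfl fun b _ => Finset.sum_congr rfl fun f _ => by ring

/-- The second moment of a sum of independent centred variables bounded by one. -/
theorem productExpect_sq_sum_le {w : ι → κ → ℝ} (hw : ∀ i, ∑ b, w i b = 1)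
    (hw0 : ∀ i b, 0 ≤ w i b) (Y : ι → κ → ℝ) (hY0 : ∀ i, ∑ b, w i b * Y i b = 0)
    (hY1 : ∀ i b, Y i b ^ 2 ≤ 1) :
    productExpect w (fun f => (∑ i, Y i (f i)) ^ 2) ≤ Fintype.card ι := by
  have hcross : ∀ i j, i ≠ j → productExpect w (fun f => Y i (f i) * Y j (f j)) = 0 := by
    intro i j hij
    rw [productExpect_resample hw i]
    simp only [Function.update_self, Function.update_of_ne hij.symm, productExpect_const_mul]
    rw [← zero_mul (productExpect w fun f => Y j (f j)), ← hY0 i, Finset.sum_mul]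
    exact Finset.sum_congr rfl fun b _ => by ring
  simp only [pow_two, Finset.sum_mul_sum, productExpect_sum]
  calc ∑ i, ∑ j, productExpect w (fun f => Y i (f i) * Y j (f j))
      = ∑ i, productExpect w (fun f => Y i (f i) * Y i (f i)) :=
        Finset.sum_congr rfl fun i _ =>
          Finset.sum_eq_single i (fun j _ hj => hcross i j hj.symm) (by simp)
    _ ≤ ∑ _i : ι, (1 : ℝ) := by
        refine Finset.sum_le_sum fun i _ => ?_
        rw [← productExpect_const hw 1]
        exact productExpect_mono hw0 fun f => by rw [← pow_two]; exact hY1 i _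
    _ = Fintype.card ι := by simp

end ProductExpectation

/-! ### The one-bit entropy inequality. -/

section Entropy

/-- Write `u = (u / (2p)) · 2p` and apply `log t ≤ t - 1` to both factors. -/
theorem mul_log_le_chiSq {p u : ℝ} (hp : 0 ≤ p) (hu : 0 < u) :
    p * Real.log u ≤ u / 2 - p + p * (2 * p - 1) := by
  rcases hp.eq_or_lt with rfl | hp
  · rw [zero_mul, zero_mul]; linarith
  · have h1 : Real.log (u / (2 * p)) ≤ u / (2 * p) - 1 := Real.log_le_sub_one_of_pos (by positivity)
    have h2 : Real.log (2 * p) ≤ 2 * p - 1 := Real.log_le_sub_one_of_pos (by positivity)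
    rw [Real.log_div hu.ne' (by positivity)] at h1
    calc p * Real.log u ≤ p * (u / (2 * p) - 1 + (2 * p - 1)) :=
          mul_le_mul_of_nonneg_left (by linarith) hp.le
      _ = u / 2 - p + p * (2 * p - 1) := by field_simp

theorem sum_zmod_two (g : ZMod 2 → ℝ) : ∑ b, g b = g 0 + g 1 := Fin.sum_univ_two g

/-- The Gibbs variational inequality for one bit, with the relative entropy to the uniform bit
bounded by the chi-square divergence. -/
theorem sum_mul_log_le {p Z : ZMod 2 → ℝ} (hp : ∀ b, 0 ≤ p b) (hp1 : ∑ b, p b = 1)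
    (hZ : ∀ b, 0 < Z b) :
    ∑ b, p b * Real.log (Z b) ≤
      ∑ b, p b * (2 * p b - 1) + Real.log (∑ b, 1 / 2 * Z b) := by
  have hM : 0 < ∑ b, 1 / 2 * Z b :=
    Finset.sum_pos (fun b _ => by have := hZ b; positivity) Finset.univ_nonempty
  set M := ∑ b, 1 / 2 * Z b with hMdef
  have h : ∀ b, p b * Real.log (Z b) ≤
      Z b / M / 2 - p b + p b * (2 * p b - 1) + p b * Real.log M := by
    intro b
    have h1 := mul_log_le_chiSq (hp b) (div_pos (hZ b) hM)
    rw [Real.log_div (hZ b).ne' hM.ne', mul_sub] at h1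
    linarith
  have hsum : Z 0 / M / 2 + Z 1 / M / 2 = 1 := by
    rw [sum_zmod_two] at hMdef
    field_simp
    linarith
  have h0 := h 0
  have h1 := h 1
  rw [sum_zmod_two] at hp1 ⊢
  rw [sum_zmod_two]
  have : p 0 * Real.log M + p 1 * Real.log M = Real.log M := by rw [← add_mul, hp1, one_mul]
  linarith

end Entropy

/-! ### Hits, and the change of measure to uniform boxes. -/

section Hits

variable {n : ℕ}

/-- With at most `q` IP queries and `m` EQ queries, and as long as EQ queries are answered by 0,
the decision tree guesses `a`, by an EQ query or by its output. -/
def Hits (a : Str n) (f : Str n → ZMod 2) : DecisionTree n → ℕ → ℕ → Prop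
  | .output s, _, _ => s = a
  | .queryIP x next, q, m => 0 < q ∧ Hits a f (next (f x)) (q - 1) m
  | .queryEQ x next, q, m => 0 < m ∧ (x = a ∨ Hits a f (next 0) q (m - 1))

/-- An EQ query answered by 1 already names `a`; until then all EQ answers are 0. Hence the path
followed in `Hits` depends only on `f`. -/
theorem hits_of_run_eq {a : Str n} {f : Str n → ZMod 2} (T : DecisionTree n) :
    ∀ q m : ℕ, T.run f (EQBox a) = a → T.countIP f (EQBox a) ≤ q →
      T.countEQ f (EQBox a) ≤ m → Hits a f T q m := by
  induction T with
  | output s => intro q m h _ _; exact h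
  | queryIP x next ih =>
    intro q m h hq hm
    simp only [DecisionTree.run, DecisionTree.countIP, DecisionTree.countEQ] at h hq hm
    exact ⟨by omega, ih _ _ _ h (by omega) hm⟩
  | queryEQ x next ih =>
    intro q m h hq hm
    simp only [DecisionTree.run, DecisionTree.countIP, DecisionTree.countEQ] at h hq hm
    refine ⟨by omega, or_iff_not_imp_left.2 fun hx => ?_⟩
    have h0 : EQBox a x = 0 := if_neg hx
    rw [h0] at h hq hm
    exact ih _ _ _ h hq (by omega)

open Classical in
/-- The indicator function of `Hits`. -/
noncomputable def hitInd (a : Str n) (T : DecisionTree n) (q m : ℕ) (f : Str n → ZMod 2) : ℝ :=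
  if Hits a f T q m then 1 else 0

theorem hitInd_nonneg (a : Str n) (T : DecisionTree n) (q m : ℕ) (f : Str n → ZMod 2) :
    0 ≤ hitInd a T q m f := by
  unfold hitInd; split_ifs <;> norm_num

theorem hitInd_output (a s : Str n) (q m : ℕ) (f : Str n → ZMod 2) :
    hitInd a (.output s) q m f = if s = a then 1 else 0 := by
  classical exact if_congr Iff.rfl rfl rfl

theorem hitInd_queryIP_zero (a x : Str n) (next : ZMod 2 → DecisionTree n) (m : ℕ)
    (f : Str n → ZMod 2) : hitInd a (.queryIP x next) 0 m f = 0 :=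
  if_neg fun h => absurd h.1 (lt_irrefl 0)

theorem hitInd_queryIP_succ (a x : Str n) (next : ZMod 2 → DecisionTree n) (q m : ℕ)
    (f : Str n → ZMod 2) :
    hitInd a (.queryIP x next) (q + 1) m f = hitInd a (next (f x)) q m f := by
  classical exact if_congr ⟨fun h => h.2, fun h => ⟨Nat.succ_pos q, h⟩⟩ rfl rfl

theorem hitInd_queryEQ_zero (a x : Str n) (next : ZMod 2 → DecisionTree n) (q : ℕ)
    (f : Str n → ZMod 2) : hitInd a (.queryEQ x next) q 0 f = 0 :=
  if_neg fun h => absurd h.1 (lt_irrefl 0)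

theorem hitInd_queryEQ_succ_self (a : Str n) (next : ZMod 2 → DecisionTree n) (q m : ℕ)
    (f : Str n → ZMod 2) : hitInd a (.queryEQ a next) q (m + 1) f = 1 :=
  if_pos ⟨Nat.succ_pos m, Or.inl rfl⟩

theorem hitInd_queryEQ_succ_of_ne {a x : Str n} (hx : x ≠ a) (next : ZMod 2 → DecisionTree n)
    (q m : ℕ) (f : Str n → ZMod 2) :
    hitInd a (.queryEQ x next) q (m + 1) f = hitInd a (next 0) q m f := by
  classical exact if_congr ⟨fun h => h.2.resolve_left hx, fun h => ⟨Nat.succ_pos m, Or.inr h⟩⟩ rfl rfl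

/-- For fixed `f` the path is the same for all `a`, and it names at most `m` strings by EQ queries
and one by the output. -/
theorem sum_hitInd_le (f : Str n → ZMod 2) (T : DecisionTree n) :
    ∀ q m : ℕ, ∑ a, hitInd a T q m f ≤ m + 1 := by
  induction T with
  | output s =>
    intro q m
    simp only [hitInd_output, Finset.sum_ite_eq, Finset.mem_univ, if_true]
    linarith [Nat.cast_nonneg (α := ℝ) m]
  | queryIP x next ih =>
    intro q m
    rcases q with _ | q
    · simp only [hitInd_queryIP_zero, Finset.sum_const_zero]
      positivity
    · simpa only [hitInd_queryIP_succ] using ih (f x) q m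
  | queryEQ x next ih =>
    intro q m
    rcases m with _ | m
    · simp [hitInd_queryEQ_zero]
    · have h : ∀ a, hitInd a (.queryEQ x next) q (m + 1) f ≤
          (if x = a then 1 else 0) + hitInd a (next 0) q m f := by
        intro a
        have h0 := hitInd_nonneg a (next 0) q m f
        by_cases hx : x = a
        · subst hx
          rw [hitInd_queryEQ_succ_self, if_pos rfl]
          linarith
        · rw [hitInd_queryEQ_succ_of_ne hx, if_neg hx, zero_add]
      refine (Finset.sum_le_sum fun a _ => h a).trans ?_
      rw [Finset.sum_add_distrib]
      have := ih 0 q m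
      simp only [Finset.sum_ite_eq, Finset.mem_univ, if_true]
      push_cast
      linarith

/-- The uniform distribution on boxes. -/
noncomputable def uniformWeight (n : ℕ) : Str n → ZMod 2 → ℝ := fun _ _ => 1 / 2

theorem sum_uniformWeight (x : Str n) : ∑ b, uniformWeight n x b = 1 := by
  rw [sum_zmod_two]; norm_num [uniformWeight]

theorem productExpect_uniform_pos {F : (Str n → ZMod 2) → ℝ} (hF : ∀ f, 0 < F f) :
    0 < productExpect (uniformWeight n) F :=
  Finset.sum_pos (fun f _ => mul_pos (Finset.prod_pos fun _ _ => by norm_num [uniformWeight])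
    (hF f)) Finset.univ_nonempty

theorem piecewise_update_of_notMem {ι κ : Type*} [DecidableEq ι] {S : Finset ι} {x : ι} (hx : x ∉ S)
    (σ f : ι → κ) (b : κ) :
    S.piecewise σ (Function.update f x b) =
      (insert x S).piecewise (Function.update σ x b) f := by
  ext i
  by_cases hi : i = x
  · subst hi; simp [Finset.piecewise, hx]
  · simp [Finset.piecewise, hi]

/-- The Donsker–Varadhan inequality for a decision tree, for boxes that are already known on `S`:
each IP query adds at most `κ` to the relative entropy. -/
theorem productExpect_hitInd_piecewise_le {w : Str n → ZMod 2 → ℝ} {κ : ℝ}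
    (hw : ∀ x, ∑ b, w x b = 1) (hw0 : ∀ x b, 0 ≤ w x b)
    (hκ : ∀ x, ∑ b, w x b * (2 * w x b - 1) ≤ κ) (hκ0 : 0 ≤ κ) (l : ℝ) (a : Str n)
    (T : DecisionTree n) :
    ∀ (q m : ℕ) (S : Finset (Str n)) (σ : Str n → ZMod 2),
      productExpect w (fun f => l * hitInd a T q m (S.piecewise σ f)) ≤
        κ * q + Real.log (productExpect (uniformWeight n)
          fun f => Real.exp (l * hitInd a T q m (S.piecewise σ f))) := by
  have hconst : ∀ (q : ℕ) (c : ℝ), productExpect w (fun _ => c) ≤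
      κ * q + Real.log (productExpect (uniformWeight n) fun _ => Real.exp c) := by
    intro q c
    rw [productExpect_const hw, productExpect_const sum_uniformWeight, Real.log_exp]
    have : 0 ≤ κ * q := by positivity
    linarith
  induction T with
  | output s =>
    intro q m S σ
    exact hconst q (l * hitInd a (.output s) q m σ)
  | queryIP x next ih =>
    intro q m S σ
    rcases q with _ | q
    · simpa only [hitInd_queryIP_zero] using hconst 0 (l * 0)
    simp only [hitInd_queryIP_succ]
    -- A repeated query has a known answer and costs no entropy; this is why the induction carries
    -- `S` and `σ`.
    by_cases hx : x ∈ S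
    · simp only [Finset.piecewise_eq_of_mem _ _ _ hx]
      refine (ih (σ x) q m S σ).trans ?_
      push_cast
      linarith
    · rw [productExpect_resample hw x, productExpect_resample sum_uniformWeight x]
      have hval : ∀ (f : Str n → ZMod 2) b,
          (insert x S).piecewise (Function.update σ x b) f x = b := by
        intro f b; simp [Finset.piecewise]
      simp only [piecewise_update_of_notMem hx, hval]
      have hb : ∀ b, _ := fun b => ih b q m (insert x S) (Function.update σ x b)
      -- Chain rule: `Z b` is the exponential moment of the subtree after answer `b`.
      have hE := sum_mul_log_le (hw0 x) (hw x) (Z := fun b => productExpect (uniformWeight n)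
          fun f => Real.exp (l * hitInd a (next b) q m
            ((insert x S).piecewise (Function.update σ x b) f)))
          (fun b => productExpect_uniform_pos fun f => Real.exp_pos _)
      refine (Finset.sum_le_sum fun b _ => mul_le_mul_of_nonneg_left (hb b) (hw0 x b)).trans ?_
      simp only [mul_add, Finset.sum_add_distrib, ← Finset.sum_mul, hw x]
      have := hκ x
      simp only [uniformWeight] at hE ⊢
      push_cast
      linarith
  | queryEQ x next ih =>
    intro q m S σ
    rcases m with _ | m
    · simpa only [hitInd_queryEQ_zero] using hconst q (l * 0)
    by_cases hx : x = a
    · subst hx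
      simpa only [hitInd_queryEQ_succ_self] using hconst q (l * 1)
    · simpa only [hitInd_queryEQ_succ_of_ne hx] using ih 0 q m S σ

/-- For an indicator `h`, `exp (l h) ≤ 1 + exp l · h`; then `log (1 + t) ≤ t`. -/
theorem mul_productExpect_hitInd_le {w : Str n → ZMod 2 → ℝ} {κ : ℝ}
    (hw : ∀ x, ∑ b, w x b = 1) (hw0 : ∀ x b, 0 ≤ w x b)
    (hκ : ∀ x, ∑ b, w x b * (2 * w x b - 1) ≤ κ) (hκ0 : 0 ≤ κ) (l : ℝ) (a : Str n)
    (T : DecisionTree n) (q m : ℕ) :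
    l * productExpect w (hitInd a T q m) ≤
      κ * q + Real.exp l * productExpect (uniformWeight n) (hitInd a T q m) := by
  have h := productExpect_hitInd_piecewise_le hw hw0 hκ hκ0 l a T q m ∅ 0
  simp only [Finset.piecewise_empty, productExpect_const_mul] at h
  refine h.trans (add_le_add le_rfl ?_)
  refine (Real.log_le_sub_one_of_pos
    (productExpect_uniform_pos fun f => Real.exp_pos _)).trans ?_
  have h2 : productExpect (uniformWeight n) (fun f => Real.exp (l * hitInd a T q m f)) ≤
      productExpect (uniformWeight n)
        -- The sum over `Bool` encodes `1 + exp l · h`, so that `productExpect_sum` applies.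
        (fun f => ∑ i : Bool, if i then 1 else Real.exp l * hitInd a T q m f) := by
    refine productExpect_mono (fun _ _ => by norm_num [uniformWeight]) fun f => ?_
    have := Real.exp_pos l
    unfold hitInd
    split_ifs <;> simp
  rw [productExpect_sum] at h2
  simp only [Fintype.sum_bool, if_true, Bool.false_eq_true, if_false, productExpect_const_mul,
    productExpect_const sum_uniformWeight] at h2
  linarith

end Hits

/-! ### Noisy boxes and their validity. -/

section NoisyBox

variable {n : ℕ}

/-- The box that answers each IP query independently, correctly with probability `1/2 + β`. -/
noncomputable def boxWeight (β : ℝ) (a x : Str n) (b : ZMod 2) : ℝ :=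
  if b = a ⬝ᵥ x then 1 / 2 + β else 1 / 2 - β

theorem sum_ite_eq_zmod_two (c : ZMod 2) (s t : ℝ) :
    ∑ b : ZMod 2, (if b = c then s else t) = s + t := by
  rw [sum_zmod_two]
  have hc : c = 0 ∨ c = 1 := by revert c; decide
  rcases hc with rfl | rfl
  · simp
  · simp [add_comm]

theorem sum_boxWeight (β : ℝ) (a x : Str n) : ∑ b, boxWeight β a x b = 1 := by
  simp only [boxWeight, sum_ite_eq_zmod_two]; ring

theorem boxWeight_nonneg {β : ℝ} (h0 : 0 ≤ β) (h1 : β ≤ 1 / 2) (a x : Str n) (b : ZMod 2) :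
    0 ≤ boxWeight β a x b := by
  unfold boxWeight; split_ifs <;> linarith

theorem chiSq_boxWeight (β : ℝ) (a x : Str n) :
    ∑ b, boxWeight β a x b * (2 * boxWeight β a x b - 1) = 4 * β ^ 2 := by
  have h : ∀ b, boxWeight β a x b * (2 * boxWeight β a x b - 1) =
      if b = a ⬝ᵥ x then (1 / 2 + β) * (2 * (1 / 2 + β) - 1)
        else (1 / 2 - β) * (2 * (1 / 2 - β) - 1) := by
    intro b; unfold boxWeight; split_ifs <;> rfl
  simp only [h, sum_ite_eq_zmod_two]
  ring

/-- The deviation of the correctness of one answer from its mean. -/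
noncomputable def deviation (β : ℝ) (a x : Str n) (b : ZMod 2) : ℝ :=
  if b = a ⬝ᵥ x then 1 / 2 - β else -(1 / 2 + β)

theorem sum_boxWeight_mul_deviation (β : ℝ) (a x : Str n) :
    ∑ b, boxWeight β a x b * deviation β a x b = 0 := by
  have h : ∀ b, boxWeight β a x b * deviation β a x b =
      if b = a ⬝ᵥ x then (1 / 2 + β) * (1 / 2 - β) else (1 / 2 - β) * -(1 / 2 + β) := by
    intro b; unfold boxWeight deviation; split_ifs <;> rfl
  simp only [h, sum_ite_eq_zmod_two]
  ring

theorem deviation_sq_le {β : ℝ} (h0 : 0 ≤ β) (h1 : β ≤ 1 / 2) (a x : Str n) (b : ZMod 2) :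
    deviation β a x b ^ 2 ≤ 1 := by
  unfold deviation; split_ifs <;> nlinarith

theorem card_str (n : ℕ) : (Fintype.card (Str n) : ℝ) = 2 ^ n := by
  simp [Str, ZMod.card]

theorem sum_deviation (β : ℝ) (a : Str n) (f : Str n → ZMod 2) :
    ∑ x, deviation β a x (f x) =
      ((Finset.univ.filter fun x : Str n => f x = a ⬝ᵥ x).card : ℝ) - (1 / 2 + β) * 2 ^ n := by
  have h : ∀ x, deviation β a x (f x) = (if f x = a ⬝ᵥ x then 1 else 0) - (1 / 2 + β) := by
    intro x; unfold deviation; split_ifs <;> ring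
  simp only [h, Finset.sum_sub_distrib, Finset.sum_const, Finset.card_univ, nsmul_eq_mul,
    card_str, Finset.sum_boole]
  ring

theorem isIPBox_iff_sum_deviation {ε : ℝ} (β : ℝ) (a : Str n) (f : Str n → ZMod 2) :
    IsIPBox ε a f ↔ (ε - β) * 2 ^ n ≤ ∑ x, deviation β a x (f x) := by
  rw [IsIPBox, sum_deviation, le_div_iff₀ (by positivity)]
  constructor <;> intro h <;> linarith

open Classical in
/-- The indicator function of the boxes with bias `ε`. -/
noncomputable def validInd (ε : ℝ) (a : Str n) (f : Str n → ZMod 2) : ℝ :=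
  if IsIPBox ε a f then 1 else 0

/-- The noise level used against bias `ε`. -/
noncomputable def noiseBias (ε : ℝ) : ℝ := if ε ≤ 1 / 4 then 2 * ε else 1 / 2

/-- For `ε ≤ 1/4` the number of correct answers has mean `(1/2 + 2ε) 2^n` and variance at most
`2^n`, so it falls short by `ε 2^n` with probability at most `1 / (ε² 2^n) ≤ 1/2`. For larger `ε`
the box is noiseless, hence valid. -/
theorem half_le_productExpect_validInd {ε : ℝ} (hε : 0 < ε) (hε2 : ε ≤ 1 / 2)
    (hN : 2 ≤ ε ^ 2 * 2 ^ n) (a : Str n) :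
    1 / 2 ≤ productExpect (boxWeight (noiseBias ε) a) (validInd ε a) := by
  by_cases h4 : ε ≤ 1 / 4
  · have hβ : noiseBias ε = 2 * ε := if_pos h4
    rw [hβ]
    have h0 : 0 ≤ 2 * ε := by positivity
    have h1 : 2 * ε ≤ 1 / 2 := by linarith
    have hN0 : (0 : ℝ) < 2 ^ n := by positivity
    have hD : 0 < (ε * 2 ^ n) ^ 2 := by positivity
    -- Chebyshev's inequality in pointwise form.
    have hcheb : ∀ f, 1 + -(1 / (ε * 2 ^ n) ^ 2) * (∑ x, deviation (2 * ε) a x (f x)) ^ 2 ≤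
        validInd ε a f := by
      intro f
      unfold validInd
      split_ifs with hv
      · have : 0 ≤ 1 / (ε * 2 ^ n) ^ 2 * (∑ x, deviation (2 * ε) a x (f x)) ^ 2 := by positivity
        linarith
      · rw [isIPBox_iff_sum_deviation (2 * ε), not_le] at hv
        have h2 : (ε * 2 ^ n) ^ 2 ≤ (∑ x, deviation (2 * ε) a x (f x)) ^ 2 := by
          have : 0 < ε * 2 ^ n := by positivity
          nlinarith
        have h3 : 1 ≤ 1 / (ε * 2 ^ n) ^ 2 * (∑ x, deviation (2 * ε) a x (f x)) ^ 2 := by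
          rw [one_div_mul_eq_div, le_div_iff₀ hD]
          linarith
        linarith
    refine le_trans ?_ (productExpect_mono (boxWeight_nonneg h0 h1 a) hcheb)
    have hsplit : productExpect (boxWeight (2 * ε) a)
        (fun f => 1 + -(1 / (ε * 2 ^ n) ^ 2) * (∑ x, deviation (2 * ε) a x (f x)) ^ 2) =
        1 + -(1 / (ε * 2 ^ n) ^ 2) *
          productExpect (boxWeight (2 * ε) a) (fun f => (∑ x, deviation (2 * ε) a x (f x)) ^ 2) := by
      rw [← productExpect_const_mul]
      simp only [productExpect, mul_add, Finset.sum_add_distrib, mul_one,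
        sum_prod_weights (sum_boxWeight (2 * ε) a)]
    rw [hsplit]
    have hm := productExpect_sq_sum_le (sum_boxWeight (2 * ε) a) (boxWeight_nonneg h0 h1 a)
      (deviation (2 * ε) a) (sum_boxWeight_mul_deviation (2 * ε) a) (deviation_sq_le h0 h1 a)
    rw [card_str] at hm
    have h5 : 1 / (ε * 2 ^ n) ^ 2 *
        productExpect (boxWeight (2 * ε) a) (fun f => (∑ x, deviation (2 * ε) a x (f x)) ^ 2) ≤
        1 / 2 := by
      rw [one_div_mul_eq_div, div_le_iff₀ hD]
      nlinarith
    linarith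
  · have hβ : noiseBias ε = 1 / 2 := if_neg h4
    rw [hβ]
    have h : ∀ f : Str n → ZMod 2, (∏ x, boxWeight (1 / 2) a x (f x)) * validInd ε a f =
        ∏ x, boxWeight (1 / 2) a x (f x) := by
      intro f
      by_cases hf : ∀ x, f x = a ⬝ᵥ x
      · have hv : IsIPBox ε a f := by
          rw [isIPBox_iff_sum_deviation (1 / 2)]
          have : ∑ x, deviation (1 / 2) a x (f x) = 0 :=
            Finset.sum_eq_zero fun x _ => by simp [deviation, hf x]
          rw [this]
          exact mul_nonpos_of_nonpos_of_nonneg (by linarith) (by positivity)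
        simp [validInd, hv]
      · push Not at hf
        obtain ⟨x, hx⟩ := hf
        have : ∏ x, boxWeight (1 / 2) a x (f x) = 0 :=
          Finset.prod_eq_zero (Finset.mem_univ x) (by simp [boxWeight, hx])
        rw [this, zero_mul]
    have h1 : productExpect (boxWeight (1 / 2) a) (validInd ε a) = 1 := by
      rw [productExpect, Finset.sum_congr rfl fun f _ => h f]
      exact sum_prod_weights (sum_boxWeight _ a)
    rw [h1]
    norm_num

theorem isIPBox_dotProduct {ε : ℝ} (hε : ε ≤ 1 / 2) (a : Str n) :
    IsIPBox ε a (fun x => a ⬝ᵥ x) := by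
  rw [isIPBox_iff_sum_deviation (1 / 2)]
  have : ∑ x : Str n, deviation (1 / 2) a x (a ⬝ᵥ x) = 0 :=
    Finset.sum_eq_zero fun x _ => by simp [deviation]
  rw [this]
  exact mul_nonpos_of_nonpos_of_nonneg (by linarith) (by positivity)

end NoisyBox

/-! ### Averaging over hidden strings, boxes and coin tosses. -/

section Average

variable {n : ℕ}

/-- Bound on the sum over all hidden strings of the success probabilities of a decision tree. -/
theorem mul_sum_productExpect_hitInd_le {β : ℝ} (h0 : 0 ≤ β) (h1 : β ≤ 1 / 2)
    (T : DecisionTree n) (q m : ℕ) :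
    Real.log (2 ^ n / (m + 1)) * ∑ a, productExpect (boxWeight β a) (hitInd a T q m) ≤
      (4 * β ^ 2 * q + 1) * 2 ^ n := by
  have hm : (0 : ℝ) < m + 1 := by positivity
  have hN : (0 : ℝ) < 2 ^ n / (m + 1) := by positivity
  rw [Finset.mul_sum]
  refine (Finset.sum_le_sum fun a _ => mul_productExpect_hitInd_le (sum_boxWeight β a)
    (boxWeight_nonneg h0 h1 a) (fun x => (chiSq_boxWeight β a x).le) (by positivity)
    (Real.log (2 ^ n / (m + 1))) a T q m).trans ?_
  -- This `l` makes `exp l · (m + 1) = 2^n`, so the uniform term contributes 1 per string.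
  rw [Real.exp_log hN, Finset.sum_add_distrib, ← Finset.mul_sum _ _ (2 ^ n / ((m : ℝ) + 1)),
    ← productExpect_sum Finset.univ (uniformWeight n) fun a => hitInd a T q m]
  have h2 : productExpect (uniformWeight n) (fun f => ∑ a, hitInd a T q m f) ≤ m + 1 := by
    rw [← productExpect_const (sum_uniformWeight (n := n)) ((m : ℝ) + 1)]
    exact productExpect_mono (fun _ _ => by norm_num [uniformWeight])
      fun f => sum_hitInd_le f T q m
  have h3 : 2 ^ n / ((m : ℝ) + 1) *
      productExpect (uniformWeight n) (fun f => ∑ a, hitInd a T q m f) ≤ 2 ^ n :=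
    (mul_le_mul_of_nonneg_left h2 hN.le).trans (div_mul_cancel₀ _ hm.ne').le
  simp only [Finset.sum_const, Finset.card_univ, nsmul_eq_mul, card_str]
  linarith

theorem ofReal_le_tsum_hitInd {A : ProbAlgorithm n} {ε δ : ℝ} (hA : Solves A ε δ) {q m : ℕ}
    {a : Str n} {f : Str n → ZMod 2} (hf : IsIPBox ε a f)
    (hq : ∀ T ∈ A.support, T.countIP f (EQBox a) ≤ q)
    (hm : ∀ T ∈ A.support, T.countEQ f (EQBox a) ≤ m) :
    ENNReal.ofReal δ ≤ ∑' T, A T * ENNReal.ofReal (hitInd a T q m f) := by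
  classical
  refine (hA a f hf).trans ?_
  rw [PMF.map_apply]
  refine ENNReal.tsum_le_tsum fun T => ?_
  split_ifs with h
  · by_cases hT : T ∈ A.support
    · have : Hits a f T q m := hits_of_run_eq T q m h.symm (hq T hT) (hm T hT)
      simp [hitInd, this]
    · rw [PMF.mem_support_iff, not_not] at hT
      simp [hT]
  · exact zero_le

/-- A probabilistic algorithm is no better on average than its best decision tree. -/
theorem le_of_forall_tree_le {A : ProbAlgorithm n} {α : Type*} (s : Finset α) {c : α → ℝ}
    (hc : ∀ i, 0 ≤ c i) {h : α → DecisionTree n → ℝ} (hh : ∀ i T, 0 ≤ h i T) {d : α → ℝ}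
    (hd : ∀ i ∈ s, ENNReal.ofReal (d i) ≤ ∑' T, A T * ENNReal.ofReal (h i T)) {B : ℝ} (hB : 0 ≤ B)
    (hT : ∀ T, ∑ i ∈ s, c i * h i T ≤ B) :
    ∑ i ∈ s, c i * d i ≤ B := by
  rw [← ENNReal.ofReal_le_ofReal_iff hB]
  calc ENNReal.ofReal (∑ i ∈ s, c i * d i)
      ≤ ∑ i ∈ s, ENNReal.ofReal (c i * d i) := by
        induction s using Finset.cons_induction with
        | empty => simp
        | cons i s hi ih =>
          rw [Finset.sum_cons, Finset.sum_cons]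
          refine ENNReal.ofReal_add_le.trans (add_le_add le_rfl (ih
            (fun j hj => hd j (Finset.mem_cons_of_mem hj)) fun T => le_trans ?_ (hT T)))
          rw [Finset.sum_cons]
          exact le_add_of_nonneg_left (mul_nonneg (hc i) (hh i T))
    _ ≤ ∑ i ∈ s, ENNReal.ofReal (c i) * ∑' T, A T * ENNReal.ofReal (h i T) := by
        refine Finset.sum_le_sum fun i hi => ?_
        rw [ENNReal.ofReal_mul (hc i)]
        exact mul_le_mul_right (hd i hi) _
    _ = ∑' T, A T * ENNReal.ofReal (∑ i ∈ s, c i * h i T) := by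
        simp only [← ENNReal.tsum_mul_left]
        rw [← Summable.tsum_finsetSum fun i _ => ENNReal.summable]
        refine tsum_congr fun T => ?_
        rw [ENNReal.ofReal_sum_of_nonneg fun i _ => mul_nonneg (hc i) (hh i T), Finset.mul_sum]
        refine Finset.sum_congr rfl fun i _ => ?_
        rw [ENNReal.ofReal_mul (hc i)]
        ring
    _ ≤ ∑' T, A T * ENNReal.ofReal B :=
        ENNReal.tsum_le_tsum fun T => mul_le_mul_right (ENNReal.ofReal_le_ofReal (hT T)) _
    _ = ENNReal.ofReal B := by rw [ENNReal.tsum_mul_right, A.tsum_coe, one_mul]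

theorem log_mul_le_of_solves {A : ProbAlgorithm n} {ε δ : ℝ} (hε : 0 < ε) (hε2 : ε ≤ 1 / 2)
    (hN : 2 ≤ ε ^ 2 * 2 ^ n) (hδ : 0 < δ) (hA : Solves A ε δ) {q m : ℕ} (hm1 : (m : ℝ) + 1 < 2 ^ n)
    (hq : ∀ (a : Str n) f, IsIPBox ε a f → ∀ T ∈ A.support, T.countIP f (EQBox a) ≤ q)
    (hm : ∀ (a : Str n) f, IsIPBox ε a f → ∀ T ∈ A.support, T.countEQ f (EQBox a) ≤ m) :
    Real.log (2 ^ n / (m + 1)) * (δ / 2) ≤ 16 * ε ^ 2 * q + 1 := by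
  have hm0 : (0 : ℝ) < m + 1 := by positivity
  have hl : 0 < Real.log (2 ^ n / (m + 1)) := Real.log_pos ((one_lt_div hm0).2 hm1)
  set l := Real.log (2 ^ n / (m + 1)) with hldef
  have hβ0 : 0 ≤ noiseBias ε := by unfold noiseBias; split_ifs <;> linarith
  have hβ1 : noiseBias ε ≤ 1 / 2 := by unfold noiseBias; split_ifs <;> linarith
  have hβ2 : noiseBias ε ≤ 2 * ε := by unfold noiseBias; split_ifs <;> linarith
  set β := noiseBias ε with hβdef
  have hN0 : (0 : ℝ) < 2 ^ n := by positivity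
  have hw : ∀ (a : Str n) (f : Str n → ZMod 2), 0 ≤ ∏ x, boxWeight β a x (f x) := fun a f =>
    Finset.prod_nonneg fun x _ => boxWeight_nonneg hβ0 hβ1 a x _
  -- The weights are not normalised: their total over all pairs is `2^n`.
  have key := le_of_forall_tree_le (A := A) (Finset.univ : Finset (Str n × (Str n → ZMod 2)))
    (c := fun p => ∏ x, boxWeight β p.1 x (p.2 x)) (fun p => hw p.1 p.2)
    (h := fun p T => hitInd p.1 T q m p.2) (fun p T => hitInd_nonneg _ _ _ _ _)
    (d := fun p => δ * validInd ε p.1 p.2)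
    (fun p _ => by
      unfold validInd
      split_ifs with hv
      · rw [mul_one]
        exact ofReal_le_tsum_hitInd hA hv (hq _ _ hv) (hm _ _ hv)
      · simp)
    (B := (4 * β ^ 2 * q + 1) * 2 ^ n / l) (by positivity)
    (fun T => by
      rw [le_div_iff₀ hl, mul_comm, Fintype.sum_prod_type]
      exact mul_sum_productExpect_hitInd_le hβ0 hβ1 T q m)
  have hlow : δ / 2 * 2 ^ n ≤
      ∑ p : Str n × (Str n → ZMod 2), (∏ x, boxWeight β p.1 x (p.2 x)) *
        (δ * validInd ε p.1 p.2) := by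
    rw [Fintype.sum_prod_type]
    have h1 : ∀ a : Str n, δ / 2 ≤
        ∑ f : Str n → ZMod 2, (∏ x, boxWeight β a x (f x)) * (δ * validInd ε a f) := by
      intro a
      have h2 := half_le_productExpect_validInd hε hε2 hN a
      have h3 := productExpect_const_mul (boxWeight β a) δ (validInd ε a)
      rw [productExpect] at h3
      rw [h3]
      nlinarith
    refine le_trans ?_ (Finset.sum_le_sum fun a _ => h1 a)
    simp only [Finset.sum_const, Finset.card_univ, nsmul_eq_mul, card_str]
    linarith
  have h4 := (le_div_iff₀ hl).1 (hlow.trans key)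
  have h5 : l * (δ / 2) ≤ 4 * β ^ 2 * q + 1 := by
    refine le_of_mul_le_mul_right ?_ hN0
    linarith
  have h6 : β ^ 2 ≤ 4 * ε ^ 2 := by nlinarith
  have h7 : β ^ 2 * q ≤ 4 * ε ^ 2 * q := mul_le_mul_of_nonneg_right h6 (by positivity)
  linarith

/-- The noiseless box is an instance, so `δ` is bounded by a probability. This turns `20 ≤ δ n` into
`20 ≤ n`. -/
theorem le_one_of_solves {A : ProbAlgorithm n} {ε δ : ℝ} (hε : ε ≤ 1 / 2)
    (hA : Solves A ε δ) : δ ≤ 1 := by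
  have h := (hA 0 _ (isIPBox_dotProduct hε 0)).trans (PMF.coe_le_one _ _)
  rwa [← ENNReal.ofReal_one, ENNReal.ofReal_le_ofReal_iff zero_le_one] at h

end Average

/-! ### Numerical estimates and the conclusion. -/

/-- The square of the lower bound on `ε`, times `2^n`, is `n 2^(n/3) ≥ n`. This is the condition for
Chebyshev. -/
theorem two_le_sq_mul_two_pow {n : ℕ} (hn : 2 ≤ n) {ε : ℝ}
    (h : Real.sqrt n * (2 : ℝ) ^ (-(n : ℝ) / 3) ≤ ε) : 2 ≤ ε ^ 2 * 2 ^ n := by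
  have h1 : (Real.sqrt n * (2 : ℝ) ^ (-(n : ℝ) / 3)) ^ 2 ≤ ε ^ 2 :=
    pow_le_pow_left₀ (by positivity) h 2
  have h2 : (Real.sqrt n * (2 : ℝ) ^ (-(n : ℝ) / 3)) ^ 2 * 2 ^ n = n * 2 ^ ((n : ℝ) / 3) := by
    rw [mul_pow, Real.sq_sqrt (Nat.cast_nonneg n), ← Real.rpow_natCast (2 : ℝ) n,
      ← Real.rpow_natCast _ 2, ← Real.rpow_mul (by norm_num), mul_assoc,
      ← Real.rpow_add (by norm_num)]
    congr 2
    push_cast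
    ring
  have h3 : (1 : ℝ) ≤ 2 ^ ((n : ℝ) / 3) := Real.one_le_rpow (by norm_num) (by positivity)
  have h4 : (2 : ℝ) ≤ n := by exact_mod_cast hn
  calc (2 : ℝ) ≤ n * 2 ^ ((n : ℝ) / 3) := by nlinarith
    _ ≤ ε ^ 2 * 2 ^ n := by rw [← h2]; exact mul_le_mul_of_nonneg_right h1 (by positivity)

end GLProblem

theorem theorem1 :
    ∃ c K : ℝ, 0 < c ∧ 0 < K ∧
      ∀ (n : ℕ) (ε δ : ℝ) (A : GLProblem.ProbAlgorithm n),
        0 < n → Real.sqrt n * (2 : ℝ) ^ (-(n : ℝ) / 3) ≤ ε → ε ≤ 1 / 2 →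
        0 < δ → K ≤ δ * n → GLProblem.Solves A ε δ →
          GLProblem.MakesMoreEQ A ε ((2 : ℝ) ^ ((n : ℝ) / 2)) ∨
          GLProblem.MakesAtLeastIP A ε (c * (δ * n / ε ^ 2)) := by
  -- `16/160 = 1/10` must lie below `0.69/4 = 0.1725`, the coefficient of `δ n` from `l δ/2`; then
  -- `0.0725 · 20 = 1.45` beats the remainder `1 + 0.345 δ`.
  refine ⟨1 / 160, 20, by norm_num, by norm_num, ?_⟩
  intro n ε δ A hn hεn hε2 hδ hK hA
  by_contra hcon
  rw [not_or] at hcon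
  obtain ⟨hEQ, hIP⟩ := hcon
  have hnR : (0 : ℝ) < n := by exact_mod_cast hn
  have hε : 0 < ε := lt_of_lt_of_le (by positivity) hεn
  have hδ1 : δ ≤ 1 := GLProblem.le_one_of_solves hε2 hA
  have hn20 : (20 : ℝ) ≤ n := by nlinarith
  have hn2 : 2 ≤ n := by
    have : (2 : ℝ) ≤ n := by linarith
    exact_mod_cast this
  set R : ℝ := (2 : ℝ) ^ ((n : ℝ) / 2) with hR
  have hR0 : 0 < R := by positivity
  have hR1 : 1 ≤ R := Real.one_le_rpow (by norm_num) (by positivity)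
  have hRR : R * R = 2 ^ n := by
    rw [hR, ← Real.rpow_add (by norm_num), add_halves, Real.rpow_natCast]
  have hR2 : 2 < R := by
    calc (2 : ℝ) = 2 ^ (1 : ℝ) := (Real.rpow_one 2).symm
      _ < R := Real.rpow_lt_rpow_of_exponent_lt (by norm_num) (by linarith)
  have hQ0 : 0 ≤ 1 / 160 * (δ * n / ε ^ 2) := by positivity
  have hmR : (⌊R⌋₊ : ℝ) ≤ R := Nat.floor_le hR0.le
  have hm1 : (⌊R⌋₊ : ℝ) + 1 < 2 ^ n := by nlinarith
  have main := GLProblem.log_mul_le_of_solves hε hε2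
    (GLProblem.two_le_sq_mul_two_pow hn2 hεn) hδ hA
    (q := ⌊1 / 160 * (δ * n / ε ^ 2)⌋₊) (m := ⌊R⌋₊) hm1
    (fun a f hf T hT => Nat.le_floor (le_of_not_ge fun h => hIP ⟨a, f, hf, T, hT, h⟩))
    (fun a f hf T hT => Nat.le_floor (le_of_not_gt fun h => hEQ ⟨a, f, hf, T, hT, h⟩))
  have hq : 16 * ε ^ 2 * (⌊1 / 160 * (δ * n / ε ^ 2)⌋₊ : ℝ) ≤ δ * n / 10 := by
    calc 16 * ε ^ 2 * (⌊1 / 160 * (δ * n / ε ^ 2)⌋₊ : ℝ)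
        ≤ 16 * ε ^ 2 * (1 / 160 * (δ * n / ε ^ 2)) :=
          mul_le_mul_of_nonneg_left (Nat.floor_le hQ0) (by positivity)
      _ = δ * n / 10 := by field_simp; norm_num
  -- Since `2^n = R²` and `⌊R⌋₊ + 1 ≤ 2R`, the quotient is at least `R / 2`.
  have hlog : ((n : ℝ) / 2 - 1) * Real.log 2 ≤ Real.log (2 ^ n / (⌊R⌋₊ + 1)) := by
    rw [← Real.log_rpow (by norm_num)]
    refine Real.log_le_log (by positivity) ?_
    rw [le_div_iff₀ (by positivity), Real.rpow_sub (by norm_num), Real.rpow_one, ← hR, ← hRR]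
    nlinarith
  have hlog2 := Real.log_two_gt_d9
  have h1 : ((n : ℝ) / 2 - 1) * 0.69 ≤ ((n : ℝ) / 2 - 1) * Real.log 2 :=
    mul_le_mul_of_nonneg_left (by linarith) (by linarith)
  have h2 : ((n : ℝ) / 2 - 1) * 0.69 * (δ / 2) ≤ Real.log (2 ^ n / (⌊R⌋₊ + 1)) * (δ / 2) :=
    mul_le_mul_of_nonneg_right (h1.trans hlog) (by positivity)
  nlinarith
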